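/- Let $\mathbb{R}^+=[0,\infty)$. An $N$-function is a differentiable convex function $\Phi:\mathbb{R}^+\to\mathbb{R}^+$ with $\lim_{t\to+\infty}\Phi(t)/t=+\infty$ and $\lim_{t\to0}\Phi(t)/t=0$. Its complementary function is $\Psi(s)=\int_0^s\psi(r)\,dr$, where $\psi$ is the inverse of $\varphi=\Phi'$ (the right-continuous inverse $\psi(r)=\sup\{t\ge 0:\varphi(t)\le r\}$ if $\varphi$ is not injective). For functions $\Phi_1,\Phi_2$ on $\mathbb{R}^+$ write $\Phi_1\prec\Phi_2$ if there are $a>0$ and $x_0\ge0$ with $\Phi_1(x)\le\Phi_2(ax)$ for all $x\ge x_0$, and $\Phi_1\lll\Phi_2$ if for every $a>0$ there is $x_0\ge0$ with $\Phi_1(x)\le\Phi_2(ax)$ for all $x\ge x_0$. Write $\Psi\in\Delta_2^\infty$ if there are $K>0$, $x_0\ge0$ with $\Psi(2x)\le K\Psi(x)$ for all $x\ge x_0$. Fix $T>0$ and an integer $d\ge1$. For measurable $u:[0,T]\to\mathbb{R}^d$ put $\rho_\Phi(u)=\int_0^T\Phi(|u|)\,dt\in[0,\infty]$, where $|\cdot|$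 is the Euclidean norm, let $L^\Phi$ be the set of measurable $u$ with $\rho_\Phi(\lambda u)<\infty$ for some $\lambda>0$, and for $u\in L^\Phi$ let $\|u\|_{L^\Phi}=\sup\{\int_0^T u\cdot v\,dt : v:[0,T]\to\mathbb{R}^d \text{ measurable},\ \rho_\Psi(v)\le1\}$. Let $\Phi$ be an $N$-function with complementary function $\Psi$. If $\Psi\in\Delta_2^\infty$, then there is an $N$-function $\Phi^*\prec\Phi$ such that for every $N$-function $\Phi_0\lll\Phi^*$ and every $k>0$, $$\lim_{\substack{u\in L^\Phi\\ \|u\|_{L^\Phi}\to\infty}}\frac{\int_0^T\Phi(|u|)\,dt}{\Phi_0(k\|u\|_{L^\Phi})}=\infty.\qquad(*)$$ Conversely, if $(*)$ holds for some $N$-function $\Phi_0$ and some $k>0$, then $\Psi\in\Delta_2^\infty$. -/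

import Mathlib

open MeasureTheory Filter Topology

namespace Orlicz

/-- A (differentiable) N-function: a function on the nonnegative half line. Functions on `[0, ∞)` are
represented by functions on `ℝ` of which only the values on `Set.Ici 0` are ever used. -/
structure IsNFunction (Φ : ℝ → ℝ) : Prop where
  nonneg : ∀ x, 0 ≤ x → 0 ≤ Φ x
  convex : ConvexOn ℝ (Set.Ici 0) Φ
  tendsto_top : Tendsto (fun t => Φ t / t) atTop atTop
  tendsto_zero : Tendsto (fun t => Φ t / t) (𝓝[>] 0) (𝓝 0)
  differentiable : DifferentiableOn ℝ Φ (Set.Ici 0)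

/-- The derivative `φ` of `Φ` on `[0, ∞)` (one-sided at `0`). -/
noncomputable def density (Φ : ℝ → ℝ) (t : ℝ) : ℝ := derivWithin Φ (Set.Ici 0) t

/-- The inverse `ψ` of the derivative `φ` of `Φ`. For an N-function, `φ` is continuous, nondecreasing and
maps `[0, ∞)` onto `[0, ∞)`; if `φ` is strictly increasing, this is its inverse bijection, and
otherwise it is the usual right-continuous inverse. -/
noncomputable def inverseDensity (Φ : ℝ → ℝ) (s : ℝ) : ℝ :=
  sSup {t : ℝ | 0 ≤ t ∧ density Φ t ≤ s}

/-- The complementary function `Ψ` of `Φ`: the primitive of `ψ` that vanishes at `0`. -/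
noncomputable def complementary (Φ : ℝ → ℝ) (s : ℝ) : ℝ :=
  ∫ r in (0 : ℝ)..s, inverseDensity Φ r

/-- `Φ₁ ≺ Φ₂`: `Φ₂` is stronger than `Φ₁`. -/
def Prec (Φ₁ Φ₂ : ℝ → ℝ) : Prop :=
  ∃ a : ℝ, 0 < a ∧ ∃ x₀ : ℝ, 0 ≤ x₀ ∧ ∀ x, x₀ ≤ x → Φ₁ x ≤ Φ₂ (a * x)

/-- `Φ₁ ⋘ Φ₂`: `Φ₂` is essentially stronger than `Φ₁`. -/
def EssPrec (Φ₁ Φ₂ : ℝ → ℝ) : Prop :=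
  ∀ a : ℝ, 0 < a → ∃ x₀ : ℝ, 0 ≤ x₀ ∧ ∀ x, x₀ ≤ x → Φ₁ x ≤ Φ₂ (a * x)

/-- The `Δ₂` condition at infinity. -/
def DeltaTwoInfty (η : ℝ → ℝ) : Prop :=
  ∃ K : ℝ, 0 < K ∧ ∃ x₀ : ℝ, 0 ≤ x₀ ∧ ∀ x, x₀ ≤ x → η (2 * x) ≤ K * η x

/-- Lebesgue measure on `[0, T]`. -/
noncomputable def leb (T : ℝ) : Measure ℝ := volume.restrict (Set.Icc 0 T)

/-- The modular `ρ_Φ(u) = ∫₀ᵀ Φ(|u|) dt ∈ [0, ∞]`, with the Euclidean norm on `ℝᵈ`. -/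
noncomputable def modular {d : ℕ} (T : ℝ) (Φ : ℝ → ℝ) (u : ℝ → EuclideanSpace ℝ (Fin d)) : ENNReal :=
  ∫⁻ t, ENNReal.ofReal (Φ ‖u t‖) ∂(leb T)

/-- The Orlicz space `L^Φ([0, T], ℝᵈ)`, as a set of (Lebesgue) measurable functions. -/
def orliczSpace (d : ℕ) (T : ℝ) (Φ : ℝ → ℝ) : Set (ℝ → EuclideanSpace ℝ (Fin d)) :=
  {u | AEMeasurable u (leb T) ∧ ∃ c : ℝ, 0 < c ∧ modular T Φ (fun t => c • u t) < ⊤}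

/-- The Orlicz norm `‖u‖ = sup {∫₀ᵀ u · v dt | ρ_Ψ(v) ≤ 1}`, with `Ψ` complementary to `Φ`. By Young's
inequality, for `u` in the Orlicz space all these integrals exist and are bounded above. -/
noncomputable def orliczNorm {d : ℕ} (T : ℝ) (Φ : ℝ → ℝ) (u : ℝ → EuclideanSpace ℝ (Fin d)) : ℝ :=
  sSup {x : ℝ | ∃ v : ℝ → EuclideanSpace ℝ (Fin d), AEMeasurable v (leb T) ∧
    modular T (complementary Φ) v ≤ 1 ∧ x = ∫ t, inner ℝ (u t) (v t) ∂(leb T)}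

/-- `ρ_Φ(u) / Φ₀(k ‖u‖) → ∞` as `‖u‖ → ∞`, `u ∈ L^Φ([0, T], ℝᵈ)`. -/
def Coercive (d : ℕ) (T : ℝ) (Φ Φ₀ : ℝ → ℝ) (k : ℝ) : Prop :=
  Tendsto (fun u : ℝ → EuclideanSpace ℝ (Fin d) =>
      modular T Φ u / ENNReal.ofReal (Φ₀ (k * orliczNorm T Φ u)))
    (comap (orliczNorm T Φ) atTop ⊓ 𝓟 (orliczSpace d T Φ)) (𝓝 ⊤)

end Orlicz

/-! Young's equality and inequality turn `Δ₂` for Ψ into Φ(lx) ≥ 2lΦ(x) for large x; iterating gives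
Φ(rx) ≥ c r^p Φ(x) with p > 1, and Φ* is x^p. Since ‖u‖ ≤ r(ρ_Φ(u/r) + 1), taking r proportional to
‖u‖ yields ρ_Φ(u) ≥ b‖u‖^p for large norm (`exists_rpow_le_modular`), which beats every Φ₀ ⋘ x^p.
Conversely, superlinearity of Φ₀ reduces coercivity to ρ_Φ(u) ≥ 2‖u‖ for large ‖u‖. Testing this on
u = x·e on an interval of length 1/Ψ(y), with x = RΨ(y)/y, gives Φ(x) ≥ 2yx, so φ(x) ≥ 2y and Ψ(2y)
≤ 2yx = 2RΨ(y) (`deltaTwo_of_two_mul_le`). -/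

namespace Orlicz

open Set

variable {Φ : ℝ → ℝ}

/-! ### Subgradients, the complementary function and Young's inequality. -/

namespace IsNFunction

theorem continuousOn (h : IsNFunction Φ) : ContinuousOn Φ (Ici 0) :=
  h.differentiable.continuousOn

theorem map_zero (h : IsNFunction Φ) : Φ 0 = 0 := by
  have h1 : Tendsto Φ (𝓝[>] 0) (𝓝 (Φ 0)) :=
    ((h.continuousOn 0 (by simp)).mono Ioi_subset_Ici_self)
  have h2 : Tendsto (fun t => Φ t / t * t) (𝓝[>] 0) (𝓝 (0 * 0)) :=
    h.tendsto_zero.mul (tendsto_id.mono_left nhdsWithin_le_nhds)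
  have h3 : Tendsto Φ (𝓝[>] 0) (𝓝 0) := by
    rw [zero_mul] at h2
    refine h2.congr' ?_
    filter_upwards [self_mem_nhdsWithin] with t ht
    exact div_mul_cancel₀ _ (ne_of_gt ht)
  exact tendsto_nhds_unique h1 h3

/-- The tangent inequality. -/
theorem tangent_le (h : IsNFunction Φ) {x t : ℝ} (hx : 0 ≤ x) (ht : 0 ≤ t) :
    Φ x + density Φ x * (t - x) ≤ Φ t := by
  rcases lt_trichotomy x t with hxt | rfl | hxt
  · have := h.convex.derivWithin_le_slope hx ht hxt (h.differentiable x hx)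
    rw [slope_def_field, le_div_iff₀ (sub_pos.2 hxt)] at this
    rw [density]; linarith
  · simp
  · have := h.convex.slope_le_derivWithin ht hx hxt (h.differentiable x hx)
    rw [slope_def_field, div_le_iff₀ (sub_pos.2 hxt)] at this
    rw [density]; linarith

theorem density_monotoneOn (h : IsNFunction Φ) : MonotoneOn (density Φ) (Ici 0) :=
  h.convex.monotoneOn_derivWithin h.differentiable

theorem density_zero (h : IsNFunction Φ) : density Φ 0 = 0 := by
  have h1 := (h.differentiable 0 (by simp)).hasDerivWithinAt
  rw [hasDerivWithinAt_iff_tendsto_slope] at h1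
  have h2 : Tendsto (slope Φ 0) (𝓝[>] 0) (𝓝 (density Φ 0)) :=
    h1.mono_left (nhdsWithin_mono _ fun x (hx : 0 < x) => ⟨hx.le, hx.ne'⟩)
  refine tendsto_nhds_unique h2 (h.tendsto_zero.congr fun t => ?_)
  simp [slope_def_field, h.map_zero]

theorem density_nonneg (h : IsNFunction Φ) {x : ℝ} (hx : 0 ≤ x) : 0 ≤ density Φ x := by
  rw [← h.density_zero]
  exact h.density_monotoneOn self_mem_Ici hx hx

theorem monotoneOn (h : IsNFunction Φ) : MonotoneOn Φ (Ici 0) := by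
  intro x hx y hy hxy
  have := h.tangent_le hx hy
  have := mul_nonneg (h.density_nonneg hx) (sub_nonneg.2 hxy)
  linarith

theorem div_le_density (h : IsNFunction Φ) {x : ℝ} (hx : 0 < x) : Φ x / x ≤ density Φ x := by
  have := h.tangent_le hx.le le_rfl
  rw [h.map_zero] at this
  rw [div_le_iff₀ hx]; linarith

theorem tendsto_density (h : IsNFunction Φ) : Tendsto (density Φ) atTop atTop := by
  refine tendsto_atTop_mono' _ ?_ h.tendsto_top
  filter_upwards [eventually_gt_atTop 0] with x hx using h.div_le_density hx

/-- Without this bound the real `sSup` in `inverseDensity` could take its default value 0. -/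
theorem bddAbove_sublevel (h : IsNFunction Φ) (s : ℝ) :
    BddAbove {t : ℝ | 0 ≤ t ∧ density Φ t ≤ s} := by
  obtain ⟨x, hx, hx0⟩ := ((h.tendsto_density.eventually_gt_atTop s).and
    (eventually_ge_atTop 0)).exists
  refine ⟨x, fun t ⟨ht, hts⟩ => ?_⟩
  by_contra! hxt
  linarith [h.density_monotoneOn hx0 ht hxt.le]

theorem inverseDensity_nonneg (s : ℝ) : 0 ≤ inverseDensity Φ s :=
  Real.sSup_nonneg fun _ ht => ht.1

theorem le_inverseDensity (h : IsNFunction Φ) {s t : ℝ} (ht : 0 ≤ t) (hts : density Φ t ≤ s) :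
    t ≤ inverseDensity Φ s :=
  le_csSup (h.bddAbove_sublevel s) ⟨ht, hts⟩

theorem inverseDensity_le (h : IsNFunction Φ) {s t : ℝ} (ht : 0 ≤ t) (hts : s < density Φ t) :
    inverseDensity Φ s ≤ t := by
  refine Real.sSup_le (fun r ⟨hr, hrs⟩ => ?_) ht
  by_contra! htr
  linarith [h.density_monotoneOn ht hr htr.le]

theorem inverseDensity_monotone (h : IsNFunction Φ) : Monotone (inverseDensity Φ) := by
  intro s s' hs
  exact Real.sSup_le (fun t ⟨ht, hts⟩ => h.le_inverseDensity ht (hts.trans hs))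
    (inverseDensity_nonneg s')

theorem exists_density_eq_slope (h : IsNFunction Φ) {a b : ℝ} (ha : 0 ≤ a) (hab : a < b) :
    ∃ c ∈ Ioo a b, density Φ c = (Φ b - Φ a) / (b - a) := by
  refine exists_hasDerivAt_eq_slope Φ (density Φ) hab
    (h.continuousOn.mono fun x hx => ha.trans hx.1) fun x hx => ?_
  have hx0 : 0 < x := ha.trans_lt hx.1
  exact (h.differentiable x hx0.le).hasDerivWithinAt.hasDerivAt (Ici_mem_nhds hx0)

/-- `s` is a subgradient of `Φ` at `inverseDensity Φ s`. -/
theorem subgradient_inverseDensity (h : IsNFunction Φ) {s t : ℝ} (hs : 0 ≤ s) (ht : 0 ≤ t) :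
    Φ (inverseDensity Φ s) + s * (t - inverseDensity Φ s) ≤ Φ t := by
  set m := inverseDensity Φ s with hm
  have hm0 : 0 ≤ m := inverseDensity_nonneg s
  rcases lt_trichotomy t m with htm | rfl | htm
  · obtain ⟨c, hc, hc'⟩ := h.exists_density_eq_slope ht htm
    have hcs : density Φ c ≤ s := by
      obtain ⟨r, ⟨hr, hrs⟩, hcr⟩ := exists_lt_of_lt_csSup
        (s := {t : ℝ | 0 ≤ t ∧ density Φ t ≤ s}) ⟨0, le_rfl, by rwa [h.density_zero]⟩ hc.2
      exact (h.density_monotoneOn (ht.trans hc.1.le) hr hcr.le).trans hrs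
    rw [hc', div_le_iff₀ (sub_pos.2 htm)] at hcs
    linarith
  · simp
  · obtain ⟨c, hc, hc'⟩ := h.exists_density_eq_slope hm0 htm
    have hcs : s ≤ density Φ c := by
      by_contra! hlt
      exact absurd (h.le_inverseDensity (hm0.trans hc.1.le) hlt.le) (not_le.2 hc.1)
    rw [hc', le_div_iff₀ (sub_pos.2 htm)] at hcs
    linarith

/-- The complementary function is the Legendre transform, attained at `inverseDensity Φ s`. -/
theorem complementary_eq (h : IsNFunction Φ) {s : ℝ} (hs : 0 ≤ s) :
    complementary Φ s = s * inverseDensity Φ s - Φ (inverseDensity Φ s) := by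
  set G : ℝ → ℝ := fun s => s * inverseDensity Φ s - Φ (inverseDensity Φ s) with hG
  have sub : ∀ a b, 0 ≤ a → 0 ≤ b → G a + (b - a) * inverseDensity Φ a ≤ G b := by
    intro a b ha hb
    have := h.subgradient_inverseDensity hb (inverseDensity_nonneg (Φ := Φ) a)
    simp only [hG]; linarith
  have hG0 : G 0 = 0 := by
    have h1 := h.subgradient_inverseDensity le_rfl le_rfl
    have h2 := h.nonneg _ (inverseDensity_nonneg (Φ := Φ) 0)
    rw [h.map_zero] at h1
    simp only [hG]; linarith
  have hcont : ContinuousOn G (Icc 0 s) := by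
    have : LipschitzOnWith (Real.toNNReal (inverseDensity Φ s)) G (Icc 0 s) := by
      refine LipschitzOnWith.of_le_add_mul _ fun a ha b hb => ?_
      rw [Real.coe_toNNReal _ (inverseDensity_nonneg s), Real.dist_eq]
      have h1 := sub a b ha.1 hb.1
      have h2 : (a - b) * inverseDensity Φ a ≤ inverseDensity Φ s * |a - b| := by
        rw [mul_comm]
        refine (mul_le_mul_of_nonneg_left (le_abs_self _) (inverseDensity_nonneg a)).trans ?_
        exact mul_le_mul_of_nonneg_right (h.inverseDensity_monotone ha.2) (abs_nonneg _)
      linarith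
    exact this.continuousOn
  have key := integral_eq_of_hasDerivAt_off_countable_of_le G (inverseDensity Φ) hs
    h.inverseDensity_monotone.countable_not_continuousAt hcont (fun x hx => ?_)
    h.inverseDensity_monotone.intervalIntegrable
  · rw [complementary, key, hG0, sub_zero]
  · have hcx : ContinuousAt (inverseDensity Φ) x := not_not.1 hx.2
    have hx0 : 0 < x := hx.1.1
    rw [hasDerivAt_iff_tendsto_slope]
    have hc' : Tendsto (inverseDensity Φ) (𝓝[≠] x) (𝓝 (inverseDensity Φ x)) :=
      hcx.tendsto.mono_left nhdsWithin_le_nhds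
    have hmin := (tendsto_const_nhds (x := inverseDensity Φ x) (f := 𝓝[≠] x)).min hc'
    have hmax := (tendsto_const_nhds (x := inverseDensity Φ x) (f := 𝓝[≠] x)).max hc'
    rw [min_self] at hmin
    rw [max_self] at hmax
    have hpos : ∀ᶠ y in 𝓝[≠] x, 0 < y ∧ y ≠ x :=
      (((lt_mem_nhds hx0).filter_mono nhdsWithin_le_nhds)).and self_mem_nhdsWithin
    have hb : ∀ y, 0 < y → y ≠ x →
        min (inverseDensity Φ x) (inverseDensity Φ y) ≤ slope G x y ∧
        slope G x y ≤ max (inverseDensity Φ x) (inverseDensity Φ y) := by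
      intro y hy hyx
      have h1 := sub x y hx0.le hy.le
      have h2 := sub y x hy.le hx0.le
      rw [slope_def_field]
      rcases lt_or_gt_of_ne hyx with hlt | hlt
      · rw [← neg_sub (G x), ← neg_sub x, neg_div_neg_eq]
        constructor
        · refine min_le_of_right_le ?_
          rw [le_div_iff₀ (sub_pos.2 hlt)]; linarith
        · refine le_max_of_le_left ?_
          rw [div_le_iff₀ (sub_pos.2 hlt)]; linarith
      · constructor
        · refine min_le_of_left_le ?_
          rw [le_div_iff₀ (sub_pos.2 hlt)]; linarith
        · refine le_max_of_le_right ?_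
          rw [div_le_iff₀ (sub_pos.2 hlt)]; linarith
    refine tendsto_of_tendsto_of_tendsto_of_le_of_le' hmin hmax ?_ ?_
    · filter_upwards [hpos] with y hy using (hb y hy.1 hy.2).1
    · filter_upwards [hpos] with y hy using (hb y hy.1 hy.2).2

/-- Young's inequality. -/
theorem mul_le_add_complementary (h : IsNFunction Φ) {x y : ℝ} (hx : 0 ≤ x) (hy : 0 ≤ y) :
    x * y ≤ Φ x + complementary Φ y := by
  have := h.subgradient_inverseDensity hy hx
  rw [h.complementary_eq hy]
  linarith

/-- The equality case of Young's inequality. -/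
theorem add_complementary_density (h : IsNFunction Φ) {x : ℝ} (hx : 0 ≤ x) :
    Φ x + complementary Φ (density Φ x) = x * density Φ x := by
  refine le_antisymm ?_ (h.mul_le_add_complementary hx (h.density_nonneg hx))
  have := h.tangent_le hx (inverseDensity_nonneg (Φ := Φ) (density Φ x))
  rw [h.complementary_eq (h.density_nonneg hx)]
  linarith

theorem complementary_nonneg (h : IsNFunction Φ) {y : ℝ} (hy : 0 ≤ y) :
    0 ≤ complementary Φ y := by
  have := h.mul_le_add_complementary le_rfl hy
  rwa [h.map_zero, zero_mul, zero_add] at this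

theorem complementary_zero : complementary Φ 0 = 0 := by simp [complementary]

/-- For r < y ≤ φ(x) the integrand satisfies ψ(r) ≤ x. -/
theorem complementary_le (h : IsNFunction Φ) {x y : ℝ} (hx : 0 ≤ x) (hy : 0 ≤ y)
    (hxy : y ≤ density Φ x) : complementary Φ y ≤ y * x := by
  have : complementary Φ y ≤ ∫ _ in (0 : ℝ)..y, x := by
    refine intervalIntegral.integral_mono_on_of_le_Ioo hy
      h.inverseDensity_monotone.intervalIntegrable intervalIntegrable_const fun r hr => ?_
    exact h.inverseDensity_le hx (hr.2.trans_le hxy)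
  simpa using this

theorem tendsto_atTop (h : IsNFunction Φ) : Tendsto Φ atTop atTop := by
  refine tendsto_atTop_mono' _ ?_ h.tendsto_top
  filter_upwards [eventually_ge_atTop 1] with x hx
  exact div_le_self (h.nonneg x (by linarith)) hx

/-! ### From `Δ₂` for Ψ to power growth of Φ. -/

/-- If the complementary function satisfies the `Δ₂` condition, then `Φ` satisfies the `∇₂`
condition. -/
theorem exists_growth_of_deltaTwo (h : IsNFunction Φ) (hΔ : DeltaTwoInfty (complementary Φ)) :
    ∃ l : ℝ, 2 ≤ l ∧ ∃ x₀ : ℝ, 0 < x₀ ∧ 0 < Φ x₀ ∧ ∀ x, x₀ ≤ x → 2 * l * Φ x ≤ Φ (l * x) := by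
  obtain ⟨K, -, y₀, hy₀, hK⟩ := hΔ
  obtain ⟨x₀, hx₀, hx₁, hx₂⟩ := ((h.tendsto_density.eventually_ge_atTop y₀).and
    ((eventually_gt_atTop 0).and (h.tendsto_atTop.eventually_gt_atTop 0))).exists
  -- With L = 2l and y = φ(x): L(Φ(x) + Ψ(y)) = Lxy = (lx)(2y) ≤ Φ(lx) + LΨ(y), and the Ψ terms
  -- cancel.
  refine ⟨max K 4 / 2, by linarith [le_max_right K 4], x₀, hx₁, hx₂, fun x hx => ?_⟩
  have hx0 : 0 ≤ x := hx₁.le.trans hx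
  set L := max K 4 with hL
  have hL4 : 4 ≤ L := le_max_right _ _
  set y := density Φ x with hy
  have hyy : y₀ ≤ y := hx₀.trans (h.density_monotoneOn hx₁.le hx0 hx)
  have hy0 : 0 ≤ y := hy₀.trans hyy
  have e1 := h.add_complementary_density hx0
  have e2 := h.mul_le_add_complementary (x := L / 2 * x) (y := 2 * y) (by positivity)
    (by positivity)
  have e3 := hK y hyy
  have e4 := mul_le_mul_of_nonneg_right (le_max_left K 4) (h.complementary_nonneg hy0)
  rw [← hL] at e4
  rw [← hy] at e1
  have e5 : L * (Φ x + complementary Φ y) = L * (x * y) := by rw [e1]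
  linarith

theorem pow_mul_le_of_mul_le {l x₀ : ℝ} (hl : 2 ≤ l) (hx₀ : 0 < x₀)
    (hg : ∀ x, x₀ ≤ x → 2 * l * Φ x ≤ Φ (l * x)) {x : ℝ} (hx : x₀ ≤ x) (n : ℕ) :
    (2 * l) ^ n * Φ x ≤ Φ (l ^ n * x) := by
  induction n with
  | zero => simp
  | succ n ih =>
    have hx0 : 0 < x := hx₀.trans_le hx
    have h1 : x₀ ≤ l ^ n * x :=
      hx.trans (le_mul_of_one_le_left hx0.le (one_le_pow₀ (by linarith)))
    have h2 := hg _ h1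
    have h3 := mul_le_mul_of_nonneg_left ih (by linarith : 0 ≤ 2 * l)
    rw [pow_succ', pow_succ', mul_assoc l, mul_assoc (2 * l)]
    linarith

/-- If the complementary function satisfies the `Δ₂` condition, then `Φ` grows at least like a
power with exponent greater than one. -/
theorem exists_rpow_growth (h : IsNFunction Φ) (hΔ : DeltaTwoInfty (complementary Φ)) :
    ∃ p : ℝ, 1 < p ∧ ∃ c : ℝ, 0 < c ∧ ∃ x₀ : ℝ, 0 < x₀ ∧ 0 < Φ x₀ ∧
      ∀ x r, x₀ ≤ x → 1 ≤ r → c * r ^ p * Φ x ≤ Φ (r * x) := by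
  obtain ⟨l, hl, x₀, hx₀, hx₁, hg⟩ := h.exists_growth_of_deltaTwo hΔ
  have hl0 : 0 < l := by linarith
  have hl1 : 1 < l := by linarith
  set p := Real.logb l (2 * l) with hp
  have hlp : l ^ p = 2 * l := Real.rpow_logb hl0 hl1.ne' (by linarith)
  have hp1 : 1 < p := by
    rw [hp, Real.lt_logb_iff_rpow_lt hl1 (by linarith), Real.rpow_one]; linarith
  refine ⟨p, hp1, (2 * l)⁻¹, by positivity, x₀, hx₀, hx₁, fun x r hx hr => ?_⟩
  have hx0 : 0 < x := hx₀.trans_le hx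
  -- Here l^n ≤ r < l^(n+1); rounding r down to l^n costs at most the factor 2l = l^p, whence the
  -- constant `(2 * l)⁻¹`.
  obtain ⟨n, hn1, hn2⟩ := exists_nat_pow_near hr hl1
  have h1 := pow_mul_le_of_mul_le hl hx₀ hg hx n
  have h2 : Φ (l ^ n * x) ≤ Φ (r * x) :=
    h.monotoneOn (mem_Ici.2 (by positivity)) (mem_Ici.2 (by positivity))
      (mul_le_mul_of_nonneg_right hn1 hx0.le)
  have h3 : r ^ p ≤ (2 * l) ^ (n + 1) := by
    rw [← hlp, ← Real.rpow_natCast, ← Real.rpow_mul hl0.le, mul_comm p, Real.rpow_mul hl0.le,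
      Real.rpow_natCast]
    exact Real.rpow_le_rpow (by linarith) hn2.le (by linarith)
  have h4 : (2 * l)⁻¹ * r ^ p ≤ (2 * l) ^ n := by
    rw [inv_mul_le_iff₀ (by positivity), ← pow_succ']; exact h3
  exact ((mul_le_mul_of_nonneg_right h4 (h.nonneg x hx0.le)).trans h1).trans h2

end IsNFunction

theorem isNFunction_rpow {p : ℝ} (hp : 1 < p) : IsNFunction (fun x => x ^ p) where
  nonneg x hx := Real.rpow_nonneg hx p
  convex := convexOn_rpow hp.le
  tendsto_top := by
    refine (tendsto_rpow_atTop (sub_pos.2 hp)).congr' ?_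
    filter_upwards [eventually_gt_atTop 0] with t ht
    rw [Real.rpow_sub_one ht.ne']
  tendsto_zero := by
    have h1 : Tendsto (fun t : ℝ => t ^ (p - 1)) (𝓝[>] 0) (𝓝 0) := by
      have := (Real.continuousAt_rpow_const 0 (p - 1) (Or.inr (by linarith))).tendsto
      rw [Real.zero_rpow (by linarith)] at this
      exact this.mono_left nhdsWithin_le_nhds
    refine h1.congr' ?_
    filter_upwards [self_mem_nhdsWithin] with t ht
    rw [Real.rpow_sub_one (ne_of_gt ht)]
  differentiable := (Real.differentiable_rpow_const hp.le).differentiableOn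

/-! ### Modular and Orlicz norm: the coercivity estimate. -/

section Modular

variable {d : ℕ} {T : ℝ}

instance : IsFiniteMeasure (leb T) := by unfold leb; infer_instance

theorem IsNFunction.aemeasurable_modular (h : IsNFunction Φ) {u : ℝ → EuclideanSpace ℝ (Fin d)}
    (hu : AEMeasurable u (leb T)) :
    AEMeasurable (fun t => ENNReal.ofReal (Φ ‖u t‖)) (leb T) := by
  -- Φ is uncontrolled on negative arguments, so it is cut off at 0.
  have hc : Continuous fun x : ℝ => Φ (max x 0) :=
    h.continuousOn.comp_continuous (by fun_prop) fun x => mem_Ici.2 (le_max_right _ _)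
  have h1 := (hc.measurable.comp_aemeasurable hu.norm).ennreal_ofReal
  refine h1.congr (.of_forall fun t => ?_)
  simp

theorem IsNFunction.integral_inner_le (h : IsNFunction Φ) {u v : ℝ → EuclideanSpace ℝ (Fin d)}
    (hu : AEMeasurable u (leb T)) (hu' : modular T Φ u ≠ ⊤)
    (hv : modular T (complementary Φ) v ≤ 1) :
    ∫ t, inner ℝ (u t) (v t) ∂(leb T) ≤ (modular T Φ u).toReal + 1 := by
  have h1 := (le_abs_self _).trans
    (norm_integral_le_lintegral_norm (μ := leb T) fun t => inner ℝ (u t) (v t))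
  have h2 : ∫⁻ t, ENNReal.ofReal ‖inner ℝ (u t) (v t)‖ ∂(leb T) ≤ modular T Φ u + 1 := by
    calc _ ≤ ∫⁻ t, (ENNReal.ofReal (Φ ‖u t‖) + ENNReal.ofReal (complementary Φ ‖v t‖)) ∂(leb T) := by
          refine lintegral_mono fun t => ?_
          rw [← ENNReal.ofReal_add (h.nonneg _ (norm_nonneg _))
            (h.complementary_nonneg (norm_nonneg _))]
          refine ENNReal.ofReal_le_ofReal ((norm_inner_le_norm _ _).trans ?_)
          exact h.mul_le_add_complementary (norm_nonneg _) (norm_nonneg _)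
      _ = modular T Φ u + modular T (complementary Φ) v :=
          lintegral_add_left' (h.aemeasurable_modular hu) _
      _ ≤ _ := by gcongr
  refine h1.trans ((ENNReal.toReal_mono (by finiteness) h2).trans ?_)
  rw [ENNReal.toReal_add hu' (by simp), ENNReal.toReal_one]

theorem IsNFunction.integral_inner_le_orliczNorm (h : IsNFunction Φ)
    {u v : ℝ → EuclideanSpace ℝ (Fin d)} (hu : AEMeasurable u (leb T)) (hu' : modular T Φ u ≠ ⊤)
    (hv : AEMeasurable v (leb T)) (hv' : modular T (complementary Φ) v ≤ 1) :
    ∫ t, inner ℝ (u t) (v t) ∂(leb T) ≤ orliczNorm T Φ u := by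
  refine le_csSup ⟨(modular T Φ u).toReal + 1, ?_⟩ ⟨v, hv, hv', rfl⟩
  rintro x ⟨w, -, hw, rfl⟩
  exact h.integral_inner_le hu hu' hw

/-- Young's inequality is applied to u/r; the free scale r is what later exploits the growth of Φ.
-/
theorem IsNFunction.orliczNorm_le (h : IsNFunction Φ) {u : ℝ → EuclideanSpace ℝ (Fin d)} {r : ℝ}
    (hr : 0 < r) (hu : AEMeasurable u (leb T)) (hu' : modular T Φ (fun t => r⁻¹ • u t) ≠ ⊤) :
    orliczNorm T Φ u ≤ r * ((modular T Φ fun t => r⁻¹ • u t).toReal + 1) := by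
  refine Real.sSup_le ?_ (by positivity)
  rintro x ⟨v, -, hv, rfl⟩
  have h1 := h.integral_inner_le (hu.const_smul r⁻¹) hu' hv
  simp only [Pi.smul_apply, real_inner_smul_left, integral_const_mul] at h1
  rwa [inv_mul_le_iff₀ hr] at h1

theorem IsNFunction.exists_rpow_le_modular (h : IsNFunction Φ) {p c x₀ : ℝ} (hc : 0 < c)
    (hx₀ : 0 < x₀) (hg : ∀ x r, x₀ ≤ x → 1 ≤ r → c * r ^ p * Φ x ≤ Φ (r * x)) :
    ∃ b : ℝ, 0 < b ∧ ∃ R : ℝ, 0 < R ∧ ∀ u : ℝ → EuclideanSpace ℝ (Fin d),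
      AEMeasurable u (leb T) → R ≤ orliczNorm T Φ u →
        ENNReal.ofReal (b * orliczNorm T Φ u ^ p) ≤ modular T Φ u := by
  set V := (leb T).real univ with hV
  have hV0 : 0 ≤ V := measureReal_nonneg
  -- With r = N/C, the bounds C ≤ ρ_Φ(u/r) + 1 and ρ_Φ(u/r) ≤ ρ_Φ(u)/(c r^p) + Φ(x₀)V leave exactly
  -- ρ_Φ(u) ≥ c r^p.
  set C := 2 + Φ x₀ * V with hC
  have hC0 : 0 < C := by have := mul_nonneg (h.nonneg x₀ hx₀.le) hV0; linarith
  refine ⟨c / C ^ p, by positivity, C, hC0, fun u hu hR => ?_⟩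
  set N := orliczNorm T Φ u with hN
  by_cases htop : modular T Φ u = ⊤
  · simp [htop]
  set r := N / C with hr
  have hr1 : 1 ≤ r := (one_le_div hC0).2 hR
  have hr0 : 0 < r := by linarith
  have hrp : 0 < c * r ^ p := by positivity
  -- The growth bound is available only where |u|/r ≥ x₀; elsewhere Φ(x₀) dominates.
  have hpt : ∀ t, Φ ‖r⁻¹ • u t‖ ≤ (c * r ^ p)⁻¹ * Φ ‖u t‖ + Φ x₀ := by
    intro t
    rcases le_total x₀ ‖r⁻¹ • u t‖ with hle | hle
    · have h1 := hg _ r hle hr1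
      rw [norm_smul, Real.norm_of_nonneg (inv_nonneg.2 hr0.le), mul_inv_cancel_left₀ hr0.ne'] at h1
      rw [norm_smul, Real.norm_of_nonneg (inv_nonneg.2 hr0.le)]
      rw [← le_inv_mul_iff₀ hrp] at h1
      linarith [h.nonneg x₀ hx₀.le]
    · have h1 := h.monotoneOn (norm_nonneg _) hx₀.le hle
      have h2 : 0 ≤ (c * r ^ p)⁻¹ * Φ ‖u t‖ :=
        mul_nonneg (inv_nonneg.2 hrp.le) (h.nonneg _ (norm_nonneg _))
      linarith
  have hmod : modular T Φ (fun t => r⁻¹ • u t) ≤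
      ENNReal.ofReal ((c * r ^ p)⁻¹) * modular T Φ u + ENNReal.ofReal (Φ x₀) * leb T univ := by
    calc _ ≤ ∫⁻ t, (ENNReal.ofReal ((c * r ^ p)⁻¹) * ENNReal.ofReal (Φ ‖u t‖)
          + ENNReal.ofReal (Φ x₀)) ∂(leb T) := by
          refine lintegral_mono fun t => ?_
          rw [← ENNReal.ofReal_mul (inv_nonneg.2 hrp.le), ← ENNReal.ofReal_add
            (mul_nonneg (inv_nonneg.2 hrp.le) (h.nonneg _ (norm_nonneg _))) (h.nonneg x₀ hx₀.le)]
          exact ENNReal.ofReal_le_ofReal (hpt t)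
      _ = _ := by
          rw [lintegral_add_right _ measurable_const, lintegral_const,
            lintegral_const_mul' _ _ ENNReal.ofReal_ne_top, modular]
  have hfin : ENNReal.ofReal ((c * r ^ p)⁻¹) * modular T Φ u
      + ENNReal.ofReal (Φ x₀) * leb T univ ≠ ⊤ := by finiteness
  have h1 := h.orliczNorm_le hr0 hu (ne_top_of_le_ne_top hfin hmod)
  have h2 := ENNReal.toReal_mono hfin hmod
  rw [ENNReal.toReal_add (by finiteness) (by finiteness), ENNReal.toReal_mul, ENNReal.toReal_mul,
    ENNReal.toReal_ofReal (inv_nonneg.2 hrp.le), ENNReal.toReal_ofReal (h.nonneg x₀ hx₀.le)] at h2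
  change _ ≤ _ + Φ x₀ * V at h2
  have h3 : N = r * C := (div_mul_cancel₀ _ hC0.ne').symm
  rw [← hN, h3] at h1
  have h4 := le_of_mul_le_mul_left h1 hr0
  have h5 : 1 ≤ (c * r ^ p)⁻¹ * (modular T Φ u).toReal := by linarith
  rw [le_inv_mul_iff₀ hrp, mul_one] at h5
  rw [ENNReal.ofReal_le_iff_le_toReal htop]
  refine le_trans (le_of_eq ?_) h5
  rw [hr, Real.div_rpow (by linarith) hC0.le]
  ring

theorem coercive_of_rpow_le {Φ₀ : ℝ → ℝ} {p b R : ℝ} (hp : 0 < p) (hb : 0 < b)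
    (hR : 0 < R) (hmod : ∀ u : ℝ → EuclideanSpace ℝ (Fin d),
      AEMeasurable u (leb T) → R ≤ orliczNorm T Φ u →
        ENNReal.ofReal (b * orliczNorm T Φ u ^ p) ≤ modular T Φ u)
    (h₀ : EssPrec Φ₀ fun x => x ^ p) {k : ℝ} (hk : 0 < k) : Coercive d T Φ Φ₀ k := by
  refine ENNReal.tendsto_nhds_top fun n => ?_
  -- Chosen so that (a·kN)^p = bN^p/(n + 1).
  set a := (b / (n + 1)) ^ p⁻¹ / k with ha
  have ha0 : 0 < a := by positivity
  obtain ⟨y₀, -, hy₀⟩ := h₀ a ha0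
  have hev : ∀ᶠ u in comap (orliczNorm (d := d) T Φ) atTop, max R (y₀ / k) ≤ orliczNorm T Φ u :=
    (eventually_ge_atTop _).comap _
  filter_upwards [hev.filter_mono inf_le_left, mem_inf_of_right (mem_principal_self _)] with u hu hu'
  set N := orliczNorm T Φ u with hN
  have hRN : R ≤ N := (le_max_left _ _).trans hu
  have hN0 : 0 < N := hR.trans_le hRN
  have hyN : y₀ ≤ k * N := by
    have := (le_max_right _ _).trans hu
    rw [div_le_iff₀ hk] at this; linarith
  have h1 := hmod u hu'.1 hRN
  have h2 : Φ₀ (k * N) * (n + 1) ≤ b * N ^ p := by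
    have h3 : Φ₀ (k * N) ≤ (a * (k * N)) ^ p := hy₀ _ hyN
    have h4 : a * (k * N) = (b / (n + 1)) ^ p⁻¹ * N := by rw [ha]; field_simp
    rw [h4, Real.mul_rpow (by positivity) hN0.le, Real.rpow_inv_rpow (by positivity) hp.ne'] at h3
    calc _ ≤ b / (n + 1) * N ^ p * (n + 1) := by gcongr
      _ = _ := by field_simp
  have h5 : ((n : ENNReal) + 1) ≤ modular T Φ u / ENNReal.ofReal (Φ₀ (k * N)) := by
    rw [ENNReal.le_div_iff_mul_le (Or.inr ?_) (Or.inl ENNReal.ofReal_ne_top)]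
    · refine le_trans ?_ h1
      have : ((n : ENNReal) + 1) = ENNReal.ofReal (n + 1) := by
        rw [ENNReal.ofReal_add (by positivity) zero_le_one]; simp
      rw [this, ← ENNReal.ofReal_mul (by positivity)]
      exact ENNReal.ofReal_le_ofReal (by linarith)
    · exact (lt_of_lt_of_le (ENNReal.ofReal_pos.2 (by positivity)) h1).ne'
  exact lt_of_lt_of_le (ENNReal.lt_add_right (by simp) one_ne_zero) h5

/-! ### Converse: from coercivity back to `Δ₂`. -/

theorem Coercive.exists_two_mul_le {Φ₀ : ℝ → ℝ} (h₀ : IsNFunction Φ₀) {k : ℝ} (hk : 0 < k)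
    (hco : Coercive d T Φ Φ₀ k) : ∃ R : ℝ, 0 < R ∧ ∀ u ∈ orliczSpace d T Φ,
      R ≤ orliczNorm T Φ u → ENNReal.ofReal (2 * orliczNorm T Φ u) ≤ modular T Φ u := by
  have h1 := hco.eventually (lt_mem_nhds ENNReal.one_lt_top)
  rw [eventually_inf_principal, eventually_comap] at h1
  have h2 : ∀ᶠ N in atTop, 2 / k ≤ Φ₀ (k * N) / (k * N) :=
    (h₀.tendsto_top.comp (tendsto_id.const_mul_atTop hk)).eventually_ge_atTop _
  obtain ⟨R, hR⟩ := eventually_atTop.1 (h1.and (h2.and (eventually_gt_atTop 0)))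
  refine ⟨R, (hR R le_rfl).2.2, fun u hu hRu => ?_⟩
  obtain ⟨e1, e2, e3⟩ := hR _ hRu
  have e4 : 2 * orliczNorm T Φ u ≤ Φ₀ (k * orliczNorm T Φ u) := by
    rw [le_div_iff₀ (by positivity)] at e2
    refine le_trans (le_of_eq ?_) e2
    field_simp
  refine (ENNReal.ofReal_le_ofReal e4).trans ?_
  have e5 := (e1 u rfl hu).le
  rw [ENNReal.le_div_iff_mul_le (Or.inl ?_) (Or.inl ENNReal.ofReal_ne_top), one_mul] at e5
  · exact e5
  · exact (ENNReal.ofReal_pos.2 (lt_of_lt_of_le (by positivity) e4)).ne'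

theorem modular_indicator {η : ℝ → ℝ} (hη : η 0 = 0) {δ : ℝ} (hδ : 0 ≤ δ) (hδT : δ ≤ T)
    {e : EuclideanSpace ℝ (Fin d)} (he : ‖e‖ = 1) {x : ℝ} (hx : 0 ≤ x) :
    modular T η ((Icc 0 δ).indicator fun _ => x • e) = ENNReal.ofReal (δ * η x) := by
  have h1 : ∀ t, ENNReal.ofReal (η ‖(Icc 0 δ).indicator (fun _ => x • e) t‖) =
      (Icc 0 δ).indicator (fun _ => ENNReal.ofReal (η x)) t := by
    intro t
    by_cases ht : t ∈ Icc 0 δ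
    · simp [ht, norm_smul, he, abs_of_nonneg hx]
    · simp [ht, hη]
  simp only [modular, h1]
  rw [lintegral_indicator measurableSet_Icc, setLIntegral_const, leb,
    Measure.restrict_apply measurableSet_Icc,
    inter_eq_left.2 (Icc_subset_Icc_right hδT), Real.volume_Icc, sub_zero,
    ENNReal.ofReal_mul hδ, mul_comm]

theorem IsNFunction.deltaTwo_of_two_mul_le (h : IsNFunction Φ) (hd : 0 < d) (hT : 0 < T) {R : ℝ}
    (hR : 0 < R) (hmod : ∀ u ∈ orliczSpace d T Φ,
      R ≤ orliczNorm T Φ u → ENNReal.ofReal (2 * orliczNorm T Φ u) ≤ modular T Φ u) :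
    DeltaTwoInfty (complementary Φ) := by
  -- The threshold and y ≤ Φ(1) + Ψ(y) give Ψ(y) ≥ 1/T, so an interval of length 1/Ψ(y) fits in [0,
  -- T].
  refine ⟨2 * R, by positivity, max 1 (T⁻¹ + Φ 1), by positivity, fun y hy => ?_⟩
  have hy0 : 0 < y := zero_lt_one.trans_le ((le_max_left _ _).trans hy)
  have hyT : T⁻¹ ≤ complementary Φ y := by
    have h1 := (le_max_right _ _).trans hy
    have h2 := h.mul_le_add_complementary zero_le_one hy0.le
    linarith
  set P := complementary Φ y with hP
  have hP0 : 0 < P := (inv_pos.2 hT).trans_le hyT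
  have hδT : P⁻¹ ≤ T := inv_le_of_inv_le₀ hT hyT
  have hδ : 0 ≤ P⁻¹ := by positivity
  -- This makes the pairing of u with v equal to xy/P = R, while v has modular 1; hence ‖u‖ ≥ R.
  set x := R * P / y with hx
  have hx0 : 0 < x := by positivity
  let e : EuclideanSpace ℝ (Fin d) := EuclideanSpace.single ⟨0, hd⟩ 1
  have he : ‖e‖ = 1 := by simp [e]
  set u : ℝ → EuclideanSpace ℝ (Fin d) := (Icc 0 P⁻¹).indicator fun _ => x • e with hu
  set v : ℝ → EuclideanSpace ℝ (Fin d) := (Icc 0 P⁻¹).indicator fun _ => y • e with hv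
  have hum : AEMeasurable u (leb T) := (measurable_const.indicator measurableSet_Icc).aemeasurable
  have hvm : AEMeasurable v (leb T) := (measurable_const.indicator measurableSet_Icc).aemeasurable
  have hmu : modular T Φ u = ENNReal.ofReal (P⁻¹ * Φ x) :=
    modular_indicator h.map_zero hδ hδT he hx0.le
  have hmv : modular T (complementary Φ) v ≤ 1 := by
    rw [hv, modular_indicator IsNFunction.complementary_zero hδ hδT he hy0.le, ← hP,
      inv_mul_cancel₀ hP0.ne', ENNReal.ofReal_one]
  have hint : ∫ t, inner ℝ (u t) (v t) ∂(leb T) = R := by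
    have h1 : ∀ t, inner ℝ (u t) (v t) = (Icc 0 P⁻¹).indicator (fun _ => x * y) t := by
      intro t
      by_cases ht : t ∈ Icc 0 P⁻¹
      · simp only [hu, hv, indicator_of_mem ht, real_inner_smul_left, real_inner_smul_right,
          real_inner_self_eq_norm_sq, he]
        ring
      · simp only [hu, hv, indicator_of_notMem ht, inner_zero_left]
    simp only [h1]
    rw [integral_indicator measurableSet_Icc, setIntegral_const, leb, measureReal_def,
      Measure.restrict_apply measurableSet_Icc, inter_eq_left.2 (Icc_subset_Icc_right hδT),
      Real.volume_Icc, sub_zero, ENNReal.toReal_ofReal hδ, smul_eq_mul, hx]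
    field_simp
  have hufin : modular T Φ u ≠ ⊤ := by rw [hmu]; exact ENNReal.ofReal_ne_top
  have huL : u ∈ orliczSpace d T Φ :=
    ⟨hum, 1, one_pos, by simpa only [one_smul] using lt_top_iff_ne_top.2 hufin⟩
  have hnorm := h.integral_inner_le_orliczNorm hum hufin hvm hmv
  rw [hint] at hnorm
  have h1 := hmod u huL hnorm
  rw [hmu, ENNReal.ofReal_le_ofReal_iff
    (mul_nonneg hδ (h.nonneg x hx0.le)), le_inv_mul_iff₀ hP0] at h1
  have hΦx : 2 * y * x ≤ Φ x := by
    have h2 : 2 * y * x = P * (2 * R) := by rw [hx]; field_simp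
    have h3 := mul_le_mul_of_nonneg_left hnorm hP0.le
    linarith
  have hden : 2 * y ≤ density Φ x := ((le_div_iff₀ hx0).2 hΦx).trans (h.div_le_density hx0)
  have h4 := h.complementary_le hx0.le (by positivity) hden
  refine h4.trans (le_of_eq ?_)
  rw [hx]; field_simp

end Modular

theorem prec_rpow_of_growth {p c x₀ : ℝ} (hp : 0 < p) (hc : 0 < c) (hx₀ : 0 < x₀) (hx₁ : 0 < Φ x₀)
    (hg : ∀ x r, x₀ ≤ x → 1 ≤ r → c * r ^ p * Φ x ≤ Φ (r * x)) :
    Prec (fun x => x ^ p) Φ := by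
  -- Normalised by cΦ(x₀)m^p = 1; growth from x₀ with ratio r = mx then gives exactly x^p.
  set m := ((c * Φ x₀)⁻¹) ^ p⁻¹ with hm
  have hm0 : 0 < m := by positivity
  refine ⟨m * x₀, by positivity, m⁻¹, by positivity, fun x hx => ?_⟩
  have hx0 : 0 < x := (inv_pos.2 hm0).trans_le hx
  have h1 : 1 ≤ m * x := by rwa [inv_le_iff_one_le_mul₀' hm0] at hx
  have h2 := hg x₀ _ le_rfl h1
  rw [Real.mul_rpow hm0.le hx0.le, hm, Real.rpow_inv_rpow (by positivity) hp.ne', ← hm] at h2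
  rw [show m * x₀ * x = m * x * x₀ by ring]
  refine le_trans (le_of_eq ?_) h2
  field_simp

end Orlicz

theorem lemma2 (d : ℕ) (hd : 0 < d) (T : ℝ) (hT : 0 < T) (Φ : ℝ → ℝ) (hΦ : Orlicz.IsNFunction Φ) :
    (Orlicz.DeltaTwoInfty (Orlicz.complementary Φ) →
      ∃ Φs : ℝ → ℝ, Orlicz.IsNFunction Φs ∧ Orlicz.Prec Φs Φ ∧
        ∀ Φ₀ : ℝ → ℝ, Orlicz.IsNFunction Φ₀ → Orlicz.EssPrec Φ₀ Φs →
          ∀ k : ℝ, 0 < k → Orlicz.Coercive d T Φ Φ₀ k) ∧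
    ((∃ Φ₀ : ℝ → ℝ, Orlicz.IsNFunction Φ₀ ∧ ∃ k : ℝ, 0 < k ∧ Orlicz.Coercive d T Φ Φ₀ k) →
      Orlicz.DeltaTwoInfty (Orlicz.complementary Φ)) := by
  refine ⟨fun hΔ => ?_, ?_⟩
  · obtain ⟨p, hp, c, hc, x₀, hx₀, hx₁, hg⟩ := hΦ.exists_rpow_growth hΔ
    have hp0 : 0 < p := by linarith
    refine ⟨fun x => x ^ p, Orlicz.isNFunction_rpow hp,
      Orlicz.prec_rpow_of_growth hp0 hc hx₀ hx₁ hg, fun Φ₀ _ hess k hk => ?_⟩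
    obtain ⟨b, hb, R, hR, hmod⟩ := hΦ.exists_rpow_le_modular (d := d) (T := T) hc hx₀ hg
    exact Orlicz.coercive_of_rpow_le hp0 hb hR hmod hess hk
  · rintro ⟨Φ₀, hΦ₀, k, hk, hco⟩
    obtain ⟨R, hR, hmod⟩ := hco.exists_two_mul_le hΦ₀ hk
    exact hΦ.deltaTwo_of_two_mul_le hd hT hR hmod
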